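/- For a prime $p$ write a nonzero $x\in\mathbb{Q}_p$ as $x=p^{v(x)}\sum_{i\ge 0}x_ip^i$ with $x_i\in\{0,\dots,p-1\}$, $x_0\neq 0$; let $|x|_p=p^{-v(x)}$, let $\{x\}_p=\sum_{0\le i<-v(x)}x_ip^{i+v(x)}\in\mathbb{Q}$ be the fractional part (with $\{0\}_p=0$), and let $\chi_p(x)=e^{2\pi i\{x\}_p}$. For $a\in\mathbb{Q}_p^\times$ define the phase $\lambda_p(a)$ as follows. If $p>2$, then $\lambda_p(a)=1$ when $v(a)$ is even, $\lambda_p(a)=\left(\frac{a_0}{p}\right)$ when $v(a)$ is odd and $p\equiv 1 \pmod 4$, and $\lambda_p(a)=i\left(\frac{a_0}{p}\right)$ when $v(a)$ is odd and $p\equiv 3\pmod 4$. If $p=2$, then $\lambda_2(a)=\frac{1}{\sqrt2}\left[1+i(-1)^{a_1}\right]$ when $v(a)$ is even and $\lambda_2(a)=\frac{1+i}{\sqrt2}\,i^{a_1}(-1)^{a_2}$ when $v(a)$ is odd. At the Archimedean place let $\chi_\infty(x)=e^{-2\pi i x}$, let $|x|_\infty$ be the usual absolute value, and let $\lambda_\infty(a)=\exp\left(-i\frac{\pi}{4}\operatorname{sgn}a\right)$.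 For $v=p$ or $v=\infty$ the free-particle propagators of mass $m$ in momentum space and in position space are $$K_v(k,t)=\chi_v\!\left(\frac{k^2t}{2m}\right),\qquad K_v(x,x',t)=\lambda_v\!\left(\frac{t}{2m}\right)\left|\frac{m}{2t}\right|_v^{1/2}\chi_v\!\left(-\frac{m(x'-x)^2}{2t}\right).$$ Then the following hold, where all products run over all primes $p$ and converge unconditionally. 1. $\chi_\infty(\alpha)=\prod_p \frac{1}{\chi_p(\alpha)}$ for every $\alpha\in\mathbb{Q}$. 2. $|\alpha|_\infty=\prod_p\frac{1}{|\alpha|_p}$ for every $\alpha\in\mathbb{Q}^\times$. 3. $\lambda_\infty(a)\prod_p\lambda_p(a)=1$ for every $a\in\mathbb{Q}^\times$. 4. For all $m,k,t\in\mathbb{Q}$ with $m\neq0$, $K_\infty(k,t)=\prod_p\frac{1}{K_p(k,t)}$. 5. For all $m,x,x',t\in\mathbb{Q}$ with $m\ne0$ and $t\neq0$, $K_\infty(x,x',t)=\prod_p\frac{1}{K_p(x,x',t)}$. The same identity holds if, at every place $v$, the factor $|m/(2t)|_v^{1/2}$ in $K_v(x,x',t)$ is replaced by $|m/t|_v^{1/2}$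 (the normalization obtained from the Gaussian integral $\int\chi_v(ak^2+bk)\,dk=\lambda_v(a)|2a|_v^{-1/2}\chi_v(-b^2/(4a))$ with $a=t/(2m)$, $b=x-x'$). -/

import Mathlib

noncomputable section

namespace FreeParticle

instance factPrimeOfPrimes (p : Nat.Primes) : Fact (p : ℕ).Prime := ⟨p.2⟩

section Padic

variable {p : ℕ} [Fact p.Prime]

theorem norm_mul_zpow_neg_valuation_le (x : ℚ_[p]) :
    ‖x * (p : ℚ_[p]) ^ (-x.valuation)‖ ≤ 1 := by
  by_cases hx : x = 0
  · simp [hx]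
  · have hp : (p : ℝ) ≠ 0 := Nat.cast_ne_zero.mpr (Fact.out : p.Prime).ne_zero
    rw [norm_mul, Padic.norm_eq_zpow_neg_valuation hx, Padic.norm_p_zpow, neg_neg,
      ← zpow_add₀ hp]
    simp

/-- The unit part `x * p ^ (-v(x))` of a `p`-adic number `x` (it is `0` for `x = 0`). -/
def unitPart (x : ℚ_[p]) : ℤ_[p] :=
  ⟨x * (p : ℚ_[p]) ^ (-x.valuation), norm_mul_zpow_neg_valuation_le x⟩

/-- The digit `x_i ∈ {0, …, p - 1}` in the expansion `x = p ^ v(x) * ∑ i, x_i * p ^ i`.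
Here `PadicInt.appr u n` is the natural number less than `p ^ n` that is congruent to `u`
modulo `p ^ n`, that is, the sum of the first `n` terms of the expansion of `u`. -/
def digit (x : ℚ_[p]) (i : ℕ) : ℕ := (unitPart x).appr (i + 1) / p ^ i

/-- The fractional part `{x}_p`: the sum of the terms of the expansion of `x` that carry a
negative power of `p`. -/
def fractPart (x : ℚ_[p]) : ℚ :=
  ∑ i ∈ Finset.range (-x.valuation).toNat, (digit x i : ℚ) * (p : ℚ) ^ (x.valuation + i)

/-- The additive character `χ_p(x) = exp(2πi {x}_p)` of `ℚ_p`. -/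
def padicChar (x : ℚ_[p]) : ℂ :=
  Complex.exp (2 * Real.pi * Complex.I * (fractPart x : ℂ))

/-- The phase factor `λ_p(a)`, for `a ≠ 0`. -/
def padicPhase (a : ℚ_[p]) : ℂ :=
  if p = 2 then
    if Even a.valuation then
      (1 / (Real.sqrt 2 : ℂ)) * (1 + Complex.I * (-1) ^ digit a 1)
    else
      ((1 + Complex.I) / (Real.sqrt 2 : ℂ)) * Complex.I ^ digit a 1 * (-1) ^ digit a 2
  else
    if Even a.valuation then 1
    else if p % 4 = 1 then (legendreSym p (digit a 0) : ℂ)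
    else Complex.I * (legendreSym p (digit a 0) : ℂ)

/-- The momentum space propagator `K_p(k, t)` of a particle of mass `m`. -/
def padicMomentumPropagator (m k t : ℚ_[p]) : ℂ :=
  padicChar (k ^ 2 * t / (2 * m))

/-- The position space propagator `K_p(x, x', t)` of a particle of mass `m`. -/
def padicPositionPropagator (m x x' t : ℚ_[p]) : ℂ :=
  padicPhase (t / (2 * m)) * ((‖m / (2 * t)‖ ^ (1 / 2 : ℝ) : ℝ) : ℂ) *
    padicChar (-(m * (x' - x) ^ 2 / (2 * t)))

/-- The position space propagator in the normalization of the Fourier transform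
`∫ K_p(k, t) χ_p(k (x - x')) dk`, which is the Gaussian integral
`∫ χ_p(a k² + b k) dk = λ_p(a) |2a|_p^(-1/2) χ_p(-b² / (4a))` with `a = t / (2m)`,
`b = x - x'`. -/
def padicFourierPropagator (m x x' t : ℚ_[p]) : ℂ :=
  padicPhase (t / (2 * m)) * ((‖m / t‖ ^ (1 / 2 : ℝ) : ℝ) : ℂ) *
    padicChar (-(m * (x' - x) ^ 2 / (2 * t)))

end Padic

section Archimedean

/-- The additive character `χ_∞(x) = exp(-2πi x)` of `ℝ`. -/
def realChar (x : ℝ) : ℂ :=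
  Complex.exp (-(2 * Real.pi * Complex.I * (x : ℂ)))

/-- The phase factor `λ_∞(a) = exp(-i (π/4) sgn a)`, for `a ≠ 0`. -/
def realPhase (a : ℝ) : ℂ :=
  Complex.exp (-(Complex.I * (Real.pi / 4) * (Real.sign a : ℂ)))

/-- The momentum space propagator `K_∞(k, t)` of a particle of mass `m`. -/
def realMomentumPropagator (m k t : ℝ) : ℂ :=
  realChar (k ^ 2 * t / (2 * m))

/-- The position space propagator `K_∞(x, x', t)` of a particle of mass `m`. -/
def realPositionPropagator (m x x' t : ℝ) : ℂ :=
  realPhase (t / (2 * m)) * ((|m / (2 * t)| ^ (1 / 2 : ℝ) : ℝ) : ℂ) *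
    realChar (-(m * (x' - x) ^ 2 / (2 * t)))

/-- The position space propagator in the normalization of the Fourier transform
`∫ K_∞(k, t) χ_∞(k (x - x')) dk`, which is the Gaussian integral
`∫ χ_∞(a k² + b k) dk = λ_∞(a) |2a|^(-1/2) χ_∞(-b² / (4a))` with `a = t / (2m)`,
`b = x - x'`. -/
def realFourierPropagator (m x x' t : ℝ) : ℂ :=
  realPhase (t / (2 * m)) * ((|m / t| ^ (1 / 2 : ℝ) : ℝ) : ℂ) *
    realChar (-(m * (x' - x) ^ 2 / (2 * t)))

end Archimedean

end FreeParticle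

end

/-! All but finitely many local factors equal `1`, so every product reduces to a finite identity.

Characters: `α` minus the sum of its fractional parts is integral at every prime, hence an integer,
so the fractional parts add up to `α` modulo `ℤ`. Norms: unique factorization.

Phases: each phase is unchanged under multiplication by nonzero squares, so `a` may be taken to be
`c * n` with `c ∈ {±1, ±2}` and `n` a product of distinct odd primes. The factors at the primes
dividing `n` are Legendre symbols times `1` or `I`; quadratic reciprocity (`prod_legendreSym_erase`)
collapses them to `J(c | n)` times `1` or `I`. The supplementary laws then cancel this against the
factors at `2` and `∞`, by a check modulo `8`.

The propagators are products of these three kinds of factors. -/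

noncomputable section
namespace FreeParticle

/-! ### Local computations in `ℚ_[p]`: digits, phases, fractional parts -/

section Local

variable {p : ℕ} [Fact p.Prime]

theorem coe_unitPart (x : ℚ_[p]) :
    (unitPart x : ℚ_[p]) = x * (p : ℚ_[p]) ^ (-x.valuation) := rfl

theorem cast_prime_ne_zero : (p : ℚ_[p]) ≠ 0 :=
  Nat.cast_ne_zero.mpr (Fact.out : p.Prime).ne_zero

theorem zpow_valuation_mul_unitPart (x : ℚ_[p]) :
    (p : ℚ_[p]) ^ x.valuation * (unitPart x : ℚ_[p]) = x := by
  rw [coe_unitPart, mul_comm, mul_assoc, ← zpow_add₀ cast_prime_ne_zero]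
  simp

theorem norm_unitPart {x : ℚ_[p]} (hx : x ≠ 0) : ‖unitPart x‖ = 1 := by
  have hp : (p : ℝ) ≠ 0 := Nat.cast_ne_zero.mpr (Fact.out : p.Prime).ne_zero
  rw [PadicInt.norm_def, coe_unitPart, norm_mul, Padic.norm_eq_zpow_neg_valuation hx,
    Padic.norm_p_zpow, neg_neg, ← zpow_add₀ hp]
  simp

theorem isUnit_unitPart {x : ℚ_[p]} (hx : x ≠ 0) : IsUnit (unitPart x) :=
  PadicInt.isUnit_iff.mpr (norm_unitPart hx)

theorem unitPart_mul {x y : ℚ_[p]} (hx : x ≠ 0) (hy : y ≠ 0) :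
    unitPart (x * y) = unitPart x * unitPart y := by
  apply Subtype.ext
  rw [PadicInt.coe_mul, coe_unitPart, coe_unitPart, coe_unitPart, Padic.valuation_mul hx hy,
    neg_add, zpow_add₀ cast_prime_ne_zero]
  ring

theorem valuation_intCast_eq_zero {z : ℤ} (hz : ¬ (p : ℤ) ∣ z) :
    (z : ℚ_[p]).valuation = 0 := by
  rw [Padic.valuation_intCast, padicValInt.eq_zero_of_not_dvd hz, Nat.cast_zero]

theorem unitPart_intCast {z : ℤ} (hz : ¬ (p : ℤ) ∣ z) :
    unitPart (z : ℚ_[p]) = z := by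
  apply Subtype.ext
  rw [coe_unitPart, valuation_intCast_eq_zero hz]
  simp

theorem unitPart_prime : unitPart (p : ℚ_[p]) = 1 := by
  apply Subtype.ext
  rw [coe_unitPart, Padic.valuation_p]
  simp

theorem appr_mod_pow (u : ℤ_[p]) (m n : ℕ) (h : m ≤ n) : u.appr n % p ^ m = u.appr m := by
  have h1 := PadicInt.dvd_appr_sub_appr u m n h
  have h2 := PadicInt.appr_mono u h
  rw [← Nat.mod_eq_of_lt (PadicInt.appr_lt u m)]
  exact ((Nat.modEq_iff_dvd' h2).mpr h1).symm

/-- Dividing truncation `i + 1` by `p ^ i` gives digit `i` as quotient and truncation `i` as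
remainder. -/
theorem sum_digit_mul_pow (x : ℚ_[p]) (n : ℕ) :
    ∑ i ∈ Finset.range n, digit x i * p ^ i = (unitPart x).appr n := by
  induction n with
  | zero => simp [PadicInt.appr]
  | succ n ih =>
    rw [Finset.sum_range_succ, ih, digit, ← appr_mod_pow _ n (n + 1) n.le_succ]
    exact Nat.mod_add_div' _ _

theorem toZMod_eq_appr_one (u : ℤ_[p]) : PadicInt.toZMod u = (u.appr 1 : ZMod p) := by
  have h := PadicInt.appr_spec 1 u
  rw [pow_one, ← PadicInt.maximalIdeal_eq_span_p, ← PadicInt.ker_toZMod, RingHom.mem_ker,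
    map_sub, sub_eq_zero, map_natCast] at h
  exact h

theorem legendreSym_digit_zero (x : ℚ_[p]) :
    legendreSym p (digit x 0) = quadraticChar (ZMod p) (PadicInt.toZMod (unitPart x)) := by
  rw [toZMod_eq_appr_one, legendreSym, digit]
  simp

/-- The phase at an odd prime in terms of the residue of the unit part. -/
theorem padicPhase_of_ne_two (hp : p ≠ 2) (a : ℚ_[p]) :
    padicPhase a = if Even a.valuation then 1 else
      (if p % 4 = 1 then 1 else Complex.I) *
        (quadraticChar (ZMod p) (PadicInt.toZMod (unitPart a)) : ℂ) := by
  rw [padicPhase, if_neg hp, legendreSym_digit_zero]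
  split_ifs <;> simp

theorem padicPhase_intCast (hp : p ≠ 2) {z : ℤ} (hz : ¬ (p : ℤ) ∣ z) :
    padicPhase (z : ℚ_[p]) = 1 := by
  rw [padicPhase_of_ne_two hp, valuation_intCast_eq_zero hz, if_pos Even.zero]

theorem padicPhase_prime_mul_intCast (hp : p ≠ 2) {z : ℤ} (hz : ¬ (p : ℤ) ∣ z) :
    padicPhase ((p : ℚ_[p]) * (z : ℚ_[p])) =
      (if p % 4 = 1 then 1 else Complex.I) * (legendreSym p z : ℂ) := by
  have hz0 : (z : ℚ_[p]) ≠ 0 := by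
    rw [Int.cast_ne_zero]; rintro rfl; exact hz (dvd_zero _)
  rw [padicPhase_of_ne_two hp, Padic.valuation_mul cast_prime_ne_zero hz0,
    valuation_intCast_eq_zero hz, Padic.valuation_p, if_neg (by decide),
    unitPart_mul cast_prime_ne_zero hz0, unitPart_prime, unitPart_intCast hz, one_mul, map_intCast,
    legendreSym]

theorem even_valuation_mul_sq {c b : ℚ_[p]} (hc : c ≠ 0) (hb : b ≠ 0) :
    Even (c * b ^ 2).valuation ↔ Even c.valuation := by
  rw [Padic.valuation_mul hc (pow_ne_zero 2 hb), Padic.valuation_pow, Int.even_add]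
  simp

theorem unitPart_mul_sq {c b : ℚ_[p]} (hc : c ≠ 0) (hb : b ≠ 0) :
    unitPart (c * b ^ 2) = unitPart c * unitPart b ^ 2 := by
  rw [unitPart_mul hc (pow_ne_zero 2 hb), sq, unitPart_mul hb hb, sq]

/-- The phase at `2` in terms of the parity of the valuation and the unit part modulo `8`. -/
theorem padicPhase_two (a : ℚ_[2]) :
    padicPhase a =
      if Even a.valuation then
        (1 / (Real.sqrt 2 : ℂ)) *
          (1 + Complex.I * (-1) ^ (ZMod.val (PadicInt.toZModPow 3 (unitPart a)) % 4 / 2))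
      else
        ((1 + Complex.I) / (Real.sqrt 2 : ℂ)) *
          Complex.I ^ (ZMod.val (PadicInt.toZModPow 3 (unitPart a)) % 4 / 2) *
          (-1) ^ (ZMod.val (PadicInt.toZModPow 3 (unitPart a)) / 4) := by
  have h : ZMod.val (PadicInt.toZModPow 3 (unitPart a)) = (unitPart a).appr 3 :=
    ZMod.val_cast_of_lt (PadicInt.appr_lt _ 3)
  have h2 := appr_mod_pow (unitPart a) 2 3 (by norm_num)
  norm_num at h2
  rw [h, h2, padicPhase, if_pos rfl, digit, digit]
  norm_num

/-- A square does not affect the parity of the valuation. Its unit part is a square, hence killed by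
the quadratic character for odd `p` and congruent to `1` modulo `8` for `p = 2`. -/
theorem padicPhase_mul_sq {c b : ℚ_[p]} (hc : c ≠ 0) (hb : b ≠ 0) :
    padicPhase (c * b ^ 2) = padicPhase c := by
  by_cases hp : p = 2
  · subst hp
    have h : PadicInt.toZModPow 3 (unitPart (c * b ^ 2)) = PadicInt.toZModPow 3 (unitPart c) := by
      obtain ⟨w, hw⟩ := (isUnit_unitPart hb).map (PadicInt.toZModPow (p := 2) 3)
      have h8 : ∀ w : (ZMod 8)ˣ, w ^ 2 = 1 := by decide
      rw [unitPart_mul_sq hc hb, map_mul, map_pow, ← hw, ← Units.val_pow_eq_pow_val,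
        show w ^ 2 = 1 from h8 w, Units.val_one, mul_one]
    simp only [padicPhase_two, even_valuation_mul_sq hc hb, h]
  · have hu : PadicInt.toZMod (unitPart b) ≠ 0 :=
      ((isUnit_unitPart hb).map PadicInt.toZMod).ne_zero
    simp only [padicPhase_of_ne_two hp, even_valuation_mul_sq hc hb]
    rw [unitPart_mul_sq hc hb, map_mul, map_pow, map_mul, quadraticChar_sq_one' hu, mul_one]

theorem padicPhase_two_intCast {z : ℤ} (hz : Odd z) :
    padicPhase (z : ℚ_[2]) =
      (1 / (Real.sqrt 2 : ℂ)) * (1 + Complex.I * (if z % 4 = 1 then 1 else -1)) := by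
  have hz2 : ¬ ((2 : ℕ) : ℤ) ∣ z := by rw [Int.odd_iff] at hz; omega
  have hv : (ZMod.val (z : ZMod (2 ^ 3)) : ℤ) = z % 8 := ZMod.val_intCast z
  rw [padicPhase_two, valuation_intCast_eq_zero hz2, if_pos Even.zero, unitPart_intCast hz2,
    map_intCast]
  rw [Int.odd_iff] at hz
  split_ifs with h
  · rw [show ZMod.val (z : ZMod (2 ^ 3)) % 4 / 2 = 0 by omega]; simp
  · rw [show ZMod.val (z : ZMod (2 ^ 3)) % 4 / 2 = 1 by omega]; simp

theorem padicPhase_two_mul_intCast {z : ℤ} (hz : Odd z) :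
    padicPhase (2 * z : ℚ_[2]) =
      ((1 + Complex.I) / (Real.sqrt 2 : ℂ)) * (if z % 4 = 1 then 1 else Complex.I) *
        (if z % 8 < 4 then 1 else -1) := by
  have hz2 : ¬ ((2 : ℕ) : ℤ) ∣ z := by rw [Int.odd_iff] at hz; omega
  have hv : (ZMod.val (z : ZMod (2 ^ 3)) : ℤ) = z % 8 := ZMod.val_intCast z
  have hz0 : (z : ℚ_[2]) ≠ 0 := by
    rw [Int.cast_ne_zero]; rintro rfl; exact hz2 (dvd_zero _)
  have h2 : ((2 : ℕ) : ℚ_[2]) ≠ 0 := cast_prime_ne_zero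
  rw [padicPhase_two, show (2 : ℚ_[2]) = ((2 : ℕ) : ℚ_[2]) by norm_num,
    Padic.valuation_mul h2 hz0, Padic.valuation_p, valuation_intCast_eq_zero hz2,
    if_neg (by decide), unitPart_mul h2 hz0, unitPart_prime, unitPart_intCast hz2, one_mul,
    map_intCast]
  rw [Int.odd_iff] at hz
  congr 1
  · split_ifs with h
    · rw [show ZMod.val (z : ZMod (2 ^ 3)) % 4 / 2 = 0 by omega]; simp
    · rw [show ZMod.val (z : ZMod (2 ^ 3)) % 4 / 2 = 1 by omega]; simp
  · split_ifs with h
    · rw [show ZMod.val (z : ZMod (2 ^ 3)) / 4 = 0 by omega]; simp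
    · rw [show ZMod.val (z : ZMod (2 ^ 3)) / 4 = 1 by omega]; simp

theorem fractPart_eq_zpow_mul_appr (x : ℚ_[p]) :
    fractPart x =
      (p : ℚ) ^ x.valuation * ((unitPart x).appr (-x.valuation).toNat : ℚ) := by
  have hp : (p : ℚ) ≠ 0 := Nat.cast_ne_zero.mpr (Fact.out : p.Prime).ne_zero
  rw [fractPart, ← sum_digit_mul_pow, Nat.cast_sum, Finset.mul_sum]
  refine Finset.sum_congr rfl fun i _ => ?_
  rw [zpow_add₀ hp, zpow_natCast]
  push_cast
  ring

theorem fractPart_eq_zero {x : ℚ_[p]} (hx : ‖x‖ ≤ 1) : fractPart x = 0 := by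
  rw [Padic.norm_le_one_iff_val_nonneg] at hx
  rw [fractPart, Int.toNat_of_nonpos (by omega), Finset.sum_range_zero]

/-- If `v(x) = -n`, truncating the unit part after `n` digits leaves a multiple of `p ^ n`, which
absorbs the factor `p ^ (-n)`. -/
theorem norm_sub_fractPart_le_one (x : ℚ_[p]) : ‖x - (fractPart x : ℚ_[p])‖ ≤ 1 := by
  by_cases hx : ‖x‖ ≤ 1
  · simpa [fractPart_eq_zero hx] using hx
  · rw [Padic.norm_le_one_iff_val_nonneg, not_le] at hx
    obtain ⟨n, hn⟩ : ∃ n : ℕ, x.valuation = -n := ⟨(-x.valuation).toNat, by omega⟩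
    obtain ⟨c, hc⟩ := Ideal.mem_span_singleton.mp (PadicInt.appr_spec n (unitPart x))
    have hc' := congrArg (fun y : ℤ_[p] => (y : ℚ_[p])) hc
    push_cast at hc'
    rw [fractPart_eq_zpow_mul_appr, hn, neg_neg, Int.toNat_natCast]
    have : x - (((p : ℚ) ^ (-(n : ℤ)) * ((unitPart x).appr n : ℚ) : ℚ) : ℚ_[p]) = c := by
      nth_rewrite 1 [← zpow_valuation_mul_unitPart x]
      push_cast
      rw [hn, ← mul_sub, hc', zpow_neg, zpow_natCast,
        inv_mul_cancel_left₀ (pow_ne_zero n cast_prime_ne_zero)]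
    rw [this]
    exact PadicInt.norm_le_one c

/-- The denominator is a power of `p`, a unit in `ℤ_[q]`. -/
theorem norm_fractPart_le_one_of_ne {q : ℕ} [Fact q.Prime] (hq : q ≠ p) (x : ℚ_[p]) :
    ‖((fractPart x : ℚ) : ℚ_[q])‖ ≤ 1 := by
  have h : ‖(p : ℚ_[q])‖ = 1 := by
    rw [Padic.norm_natCast_eq_one_iff]
    exact (Nat.coprime_primes Fact.out Fact.out).mpr hq
  rw [fractPart_eq_zpow_mul_appr]
  push_cast
  rw [norm_mul, norm_zpow, h, one_zpow, one_mul]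
  exact Padic.norm_int_le_one ((unitPart x).appr _ : ℤ)

end Local

open scoped NumberTheorySymbols

/-- The prime `2`. -/
def twoPrime : Nat.Primes := ⟨2, Nat.prime_two⟩

/-- The prime divisors of `n`, as a finite set of primes. -/
def primesDividing (n : ℕ) : Finset Nat.Primes := n.primeFactors.subtype Nat.Prime

theorem mem_primesDividing {n : ℕ} {p : Nat.Primes} :
    p ∈ primesDividing n ↔ (p : ℕ) ∈ n.primeFactors := Finset.mem_subtype

theorem prod_primesDividing (n : ℕ) (f : ℕ → ℕ) :
    ∏ p ∈ primesDividing n, f p = ∏ p ∈ n.primeFactors, f p :=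
  Finset.prod_subtype_of_mem f fun _ hp => Nat.prime_of_mem_primeFactors hp

/-! ### Product formula for the phases, via quadratic reciprocity -/

section Phase

theorem sqrt_two_inv_mul_self : ((Real.sqrt 2 : ℂ))⁻¹ * (Real.sqrt 2 : ℂ)⁻¹ * 2 = 1 := by
  have h : (Real.sqrt 2 : ℂ) * (Real.sqrt 2 : ℂ) = 2 := by
    rw [← Complex.ofReal_mul, Real.mul_self_sqrt zero_le_two, Complex.ofReal_ofNat]
  rw [← mul_inv, h, inv_mul_cancel₀ two_ne_zero]

theorem cos_pi_div_four_eq_inv : ((Real.cos (Real.pi / 4) : ℝ) : ℂ) = (Real.sqrt 2 : ℂ)⁻¹ := by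
  rw [Real.cos_pi_div_four]
  have h := sqrt_two_inv_mul_self
  have h0 : (Real.sqrt 2 : ℂ) ≠ 0 := by simp
  push_cast
  field_simp at h ⊢
  exact h.symm

theorem sin_pi_div_four_eq_inv : ((Real.sin (Real.pi / 4) : ℝ) : ℂ) = (Real.sqrt 2 : ℂ)⁻¹ := by
  rw [Real.sin_pi_div_four, ← Real.cos_pi_div_four, cos_pi_div_four_eq_inv]

theorem realPhase_of_pos {a : ℝ} (ha : 0 < a) :
    realPhase a = (Real.sqrt 2 : ℂ)⁻¹ * (1 - Complex.I) := by
  rw [realPhase, Real.sign_of_pos ha,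
    show -(Complex.I * (Real.pi / 4) * ((1 : ℝ) : ℂ)) = ((-(Real.pi / 4) : ℝ) : ℂ) * Complex.I by
      push_cast; ring,
    Complex.exp_mul_I, ← Complex.ofReal_cos, ← Complex.ofReal_sin, Real.cos_neg, Real.sin_neg,
    Complex.ofReal_neg, cos_pi_div_four_eq_inv, sin_pi_div_four_eq_inv]
  ring

theorem realPhase_of_neg {a : ℝ} (ha : a < 0) :
    realPhase a = (Real.sqrt 2 : ℂ)⁻¹ * (1 + Complex.I) := by
  rw [realPhase, Real.sign_of_neg ha,
    show -(Complex.I * (Real.pi / 4) * ((-1 : ℝ) : ℂ)) = ((Real.pi / 4 : ℝ) : ℂ) * Complex.I by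
      push_cast; ring,
    Complex.exp_mul_I, ← Complex.ofReal_cos, ← Complex.ofReal_sin, cos_pi_div_four_eq_inv,
    sin_pi_div_four_eq_inv]
  ring

theorem realPhase_mul_of_pos (a : ℝ) {b : ℝ} (hb : 0 < b) :
    realPhase (a * b) = realPhase a := by
  have h : Real.sign (a * b) = Real.sign a := by
    rcases lt_trichotomy a 0 with h | h | h
    · rw [Real.sign_of_neg h, Real.sign_of_neg (mul_neg_of_neg_of_pos h hb)]
    · simp [h]
    · rw [Real.sign_of_pos h, Real.sign_of_pos (mul_pos h hb)]
  rw [realPhase, realPhase, h]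

theorem odd_prod_primes {S : Finset Nat.Primes} (hS : ∀ p ∈ S, (p : ℕ) ≠ 2) :
    Odd (∏ p ∈ S, (p : ℕ)) := by
  induction S using Finset.induction_on with
  | empty => simp
  | insert q S hq ih =>
    rw [Finset.prod_insert hq]
    exact (q.2.odd_of_ne_two (hS q (Finset.mem_insert_self q S))).mul
      (ih fun p hp => hS p (Finset.mem_insert_of_mem hp))

theorem not_dvd_prod_primes {S : Finset Nat.Primes} {q : Nat.Primes} (hq : q ∉ S) :
    ¬ (q : ℕ) ∣ ∏ p ∈ S, (p : ℕ) := by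
  intro h
  obtain ⟨p, hp, hqp⟩ := (Prime.dvd_finsetProd_iff q.2.prime _).mp h
  have : q = p := Subtype.ext ((Nat.prime_dvd_prime_iff_eq q.2 p.2).mp hqp)
  exact hq (this ▸ hp)

/-- A form of quadratic reciprocity for finite sets of odd primes. -/
theorem prod_legendreSym_erase (S : Finset Nat.Primes) (hS : ∀ p ∈ S, (p : ℕ) ≠ 2) (c : ℤ) :
    ∏ p ∈ S, (if (p : ℕ) % 4 = 1 then 1 else Complex.I) *
        (legendreSym p (c * (∏ q ∈ S.erase p, (q : ℕ) : ℕ)) : ℂ) =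
      (J(c | ∏ p ∈ S, (p : ℕ)) : ℂ) *
        (if (∏ p ∈ S, (p : ℕ)) % 4 = 1 then 1 else Complex.I) := by
  induction S using Finset.induction_on generalizing c with
  | empty => simp
  | insert q S hq ih =>
    have hS' : ∀ p ∈ S, (p : ℕ) ≠ 2 := fun p hp => hS p (Finset.mem_insert_of_mem hp)
    have hqo : Odd (q : ℕ) := q.2.odd_of_ne_two (hS q (Finset.mem_insert_self q S))
    have hno := odd_prod_primes hS'
    have hnd := not_dvd_prod_primes hq
    -- At the old primes the new prime `q` is absorbed into the constant, so the induction
    -- hypothesis applies to `c * q`.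
    have hstep : ∀ p ∈ S, (if (p : ℕ) % 4 = 1 then 1 else Complex.I) *
        (legendreSym p (c * (∏ r ∈ (insert q S).erase p, (r : ℕ) : ℕ)) : ℂ) =
        (if (p : ℕ) % 4 = 1 then 1 else Complex.I) *
        (legendreSym p (c * q * (∏ r ∈ S.erase p, (r : ℕ) : ℕ)) : ℂ) := by
      intro p hp
      have hpq : q ≠ p := fun h => hq (h ▸ hp)
      rw [Finset.erase_insert_of_ne hpq,
        Finset.prod_insert (fun h => hq (Finset.mem_of_mem_erase h)), Nat.cast_mul, mul_assoc]
    rw [Finset.prod_insert hq, Finset.prod_congr rfl hstep, ih hS', Finset.erase_insert hq,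
      Finset.prod_insert hq]
    set n := ∏ p ∈ S, (p : ℕ)
    have hn0 : n ≠ 0 := fun h => by simp [h] at hno
    rw [jacobiSym.legendreSym.to_jacobiSym, jacobiSym.mul_right' c q.2.ne_zero hn0,
      jacobiSym.mul_left, jacobiSym.mul_left]
    have hcop : ((n : ℤ)).gcd (q : ℕ) = 1 := by
      rw [Int.gcd_natCast_natCast]
      exact ((Nat.Prime.coprime_iff_not_dvd q.2).mpr hnd).symm
    have hsq : (J((n : ℤ) | q) : ℂ) * (J((n : ℤ) | q) : ℂ) = 1 := by
      rw [← sq]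
      exact_mod_cast jacobiSym.sq_one hcop
    have hI := Complex.I_mul_I
    have hmod := Nat.mul_mod (q : ℕ) n 4
    -- The symbols `J(q | n)` and `J(n | q)` cancel up to the reciprocity sign. That sign is `-1`
    -- only when both are `3` modulo `4`, where it matches `I * I`.
    rcases Nat.odd_mod_four_iff.mp (Nat.odd_iff.mp hqo) with h1 | h1 <;>
    rcases Nat.odd_mod_four_iff.mp (Nat.odd_iff.mp hno) with h2 | h2
    · rw [jacobiSym.quadratic_reciprocity_one_mod_four h1 hno]
      rw [hmod, h1, h2]
      norm_num
      linear_combination (J(c | q) : ℂ) * (J(c | n) : ℂ) * hsq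
    · rw [jacobiSym.quadratic_reciprocity_one_mod_four h1 hno]
      rw [hmod, h1, h2]
      norm_num
      linear_combination (J(c | q) : ℂ) * (J(c | n) : ℂ) * Complex.I * hsq
    · rw [jacobiSym.quadratic_reciprocity_one_mod_four' hqo h2]
      rw [hmod, h1, h2]
      norm_num
      linear_combination (J(c | q) : ℂ) * (J(c | n) : ℂ) * Complex.I * hsq
    · rw [jacobiSym.quadratic_reciprocity_three_mod_four h1 h2]
      rw [hmod, h1, h2]
      norm_num
      linear_combination (J(c | q) : ℂ) * (J(c | n) : ℂ) * (hsq -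
        (J((n : ℤ) | q) : ℂ) * (J((n : ℤ) | q) : ℂ) * hI)

/-- Every nonzero rational number is, up to a square, `±1` or `±2` times a product of distinct odd
primes. -/
theorem exists_eq_mul_prod_primes_mul_sq {a : ℚ} (ha : a ≠ 0) :
    ∃ c : ℤ, (c = 1 ∨ c = -1 ∨ c = 2 ∨ c = -2) ∧ ∃ S : Finset Nat.Primes,
      (∀ p ∈ S, (p : ℕ) ≠ 2) ∧ ∃ b : ℚ, b ≠ 0 ∧ a = ((c * (∏ p ∈ S, (p : ℕ) : ℕ) : ℤ) : ℚ) * b ^ 2 := by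
  have hden : (a.den : ℚ) ≠ 0 := Nat.cast_ne_zero.mpr a.den_ne_zero
  have hk : 0 < (a.num * a.den).natAbs :=
    Int.natAbs_pos.mpr (mul_ne_zero (Rat.num_ne_zero.mpr ha) (Int.natCast_ne_zero.mpr a.den_ne_zero))
  obtain ⟨m, d, hm0, hd0, hmd, hsf⟩ := Nat.sq_mul_squarefree_of_pos hk
  -- Modulo squares `a` is the integer `num * den`, whose squarefree part supplies the primes.
  have ha' : a = ((a.num * a.den : ℤ) : ℚ) * ((a.den : ℚ)⁻¹) ^ 2 := by
    conv_lhs => rw [← Rat.num_div_den a]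
    push_cast
    field_simp
  obtain ⟨s, hs, hsk⟩ : ∃ s : ℤ, (s = 1 ∨ s = -1) ∧ a.num * a.den = s * (m * d ^ 2) := by
    have hmd' : ((a.num * a.den).natAbs : ℤ) = m * d ^ 2 := by rw [← hmd]; push_cast; ring
    rcases Int.natAbs_eq (a.num * a.den) with h | h
    · exact ⟨1, Or.inl rfl, by rw [h, hmd', one_mul]⟩
    · exact ⟨-1, Or.inr rfl, by rw [h, hmd', neg_one_mul]⟩
  obtain ⟨T, hT⟩ : ∃ T : Finset Nat.Primes, ∏ p ∈ T, (p : ℕ) = m := by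
    exact ⟨primesDividing m, (prod_primesDividing m fun p => p).trans
      (Nat.prod_primeFactors_of_squarefree hsf)⟩
  obtain ⟨e, he, hem⟩ : ∃ e : ℤ, (e = 1 ∨ e = 2) ∧
      (m : ℤ) = e * (∏ p ∈ T.erase twoPrime, (p : ℕ) : ℕ) := by
    by_cases h2 : twoPrime ∈ T
    · refine ⟨2, Or.inr rfl, ?_⟩
      rw [← hT, ← Finset.mul_prod_erase T _ h2]
      push_cast
      rfl
    · exact ⟨1, Or.inl rfl, by rw [Finset.erase_eq_of_notMem h2, hT, one_mul]⟩
  refine ⟨s * e, ?_, T.erase twoPrime, ?_, d * (a.den : ℚ)⁻¹, ?_, ?_⟩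
  · rcases hs with rfl | rfl <;> rcases he with rfl | rfl <;> norm_num
  · intro p hp h
    exact Finset.ne_of_mem_erase hp (Subtype.ext h)
  · exact mul_ne_zero (Nat.cast_ne_zero.mpr hd0.ne') (inv_ne_zero hden)
  · rw [mul_assoc s e, ← hem]
    conv_lhs => rw [ha', hsk]
    push_cast
    ring

/-- For each `c` the supplementary laws make every factor depend only on `n` modulo `8`, leaving
four residues to check. -/
theorem realPhase_mul_padicPhase_two_mul_jacobiSym {c : ℤ}
    (hc : c = 1 ∨ c = -1 ∨ c = 2 ∨ c = -2) {n : ℕ} (hn : Odd n) :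
    realPhase ((c * n : ℤ) : ℝ) * (padicPhase ((c * n : ℤ) : ℚ_[2]) *
      ((J(c | n) : ℂ) * (if n % 4 = 1 then 1 else Complex.I))) = 1 := by
  have hpos : (0 : ℝ) < n := Nat.cast_pos.mpr hn.pos
  have hsq := sqrt_two_inv_mul_self
  have hI := Complex.I_mul_I
  have ho : Odd (n : ℤ) := by exact_mod_cast hn
  have ho' : Odd (-n : ℤ) := ho.neg
  have hn2 := Nat.odd_iff.mp hn
  have h8 : n % 8 = 1 ∨ n % 8 = 3 ∨ n % 8 = 5 ∨ n % 8 = 7 := by omega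
  have c1 : (n : ℤ) % 4 = 1 ↔ n % 8 = 1 ∨ n % 8 = 5 := by omega
  have c2 : (-n : ℤ) % 4 = 1 ↔ n % 8 = 3 ∨ n % 8 = 7 := by omega
  have c3 : (n : ℤ) % 8 < 4 ↔ n % 8 = 1 ∨ n % 8 = 3 := by omega
  have c4 : (-n : ℤ) % 8 < 4 ↔ n % 8 = 5 ∨ n % 8 = 7 := by omega
  have c5 : n % 4 = 1 ↔ n % 8 = 1 ∨ n % 8 = 5 := by omega
  have c6 : n % 2 = 0 ↔ False := by simp [hn2]
  rcases hc with rfl | rfl | rfl | rfl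
  · rw [one_mul, Int.cast_natCast (R := ℝ), realPhase_of_pos hpos, padicPhase_two_intCast ho,
      jacobiSym.one_left]
    simp only [c1, c5]
    rcases h8 with h | h | h | h <;> simp only [h, one_div] at hsq ⊢ <;> norm_num <;> grind
  · rw [neg_one_mul, Int.cast_neg (R := ℝ), Int.cast_natCast (R := ℝ),
      realPhase_of_neg (neg_lt_zero.mpr hpos), padicPhase_two_intCast ho',
      jacobiSym.at_neg_one hn, ZMod.χ₄_nat_eq_if_mod_four]
    simp only [c2, c5, c6]
    rcases h8 with h | h | h | h <;> simp only [h, one_div] at hsq ⊢ <;> norm_num <;> grind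
  · have h1 : ((2 * (n : ℤ) : ℤ) : ℚ_[2]) = 2 * ((n : ℤ) : ℚ_[2]) := by push_cast; rfl
    rw [h1, realPhase_of_pos (by push_cast; positivity), padicPhase_two_mul_intCast ho,
      jacobiSym.at_two hn, ZMod.χ₈_nat_eq_if_mod_eight]
    simp only [c1, c3, c5, c6]
    rcases h8 with h | h | h | h <;> simp only [h, div_eq_mul_inv] at hsq ⊢ <;> norm_num <;> grind
  · have h1 : ((-2 * (n : ℤ) : ℤ) : ℚ_[2]) = 2 * ((-n : ℤ) : ℚ_[2]) := by push_cast; ring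
    rw [h1, realPhase_of_neg (by push_cast; linarith), padicPhase_two_mul_intCast ho',
      jacobiSym.at_neg_two hn, ZMod.χ₈'_nat_eq_if_mod_eight]
    simp only [c2, c4, c5, c6]
    rcases h8 with h | h | h | h <;> simp only [h, div_eq_mul_inv] at hsq ⊢ <;> norm_num <;> grind

theorem hasProd_padicPhase {a : ℚ} (ha : a ≠ 0) :
    HasProd (fun p : Nat.Primes => padicPhase (a : ℚ_[p])) (realPhase (a : ℝ))⁻¹ := by
  obtain ⟨c, hc, S, hS, b, hb, rfl⟩ := exists_eq_mul_prod_primes_mul_sq ha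
  have hc0 : c ≠ 0 := by rcases hc with rfl | rfl | rfl | rfl <;> norm_num
  have hno := odd_prod_primes hS
  -- Since `c` divides `2`, no odd prime divides it.
  have hndvd : ∀ {p : Nat.Primes} {T : Finset Nat.Primes}, (p : ℕ) ≠ 2 → p ∉ T →
      ¬ ((p : ℕ) : ℤ) ∣ c * (∏ q ∈ T, (q : ℕ) : ℕ) := by
    intro p T hp hT h
    rcases (Nat.prime_iff_prime_int.mp p.2).dvd_mul.mp h with h | h
    · have h2 : ((p : ℕ) : ℤ) ∣ 2 := by
        rcases hc with rfl | rfl | rfl | rfl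
        · exact h.trans (by norm_num)
        · exact h.trans (by norm_num)
        · exact h
        · exact h.trans (by norm_num)
      exact hp ((Nat.prime_dvd_prime_iff_eq p.2 Nat.prime_two).mp (by exact_mod_cast h2))
    · exact not_dvd_prod_primes hT (Int.natCast_dvd_natCast.mp h)
  have key := realPhase_mul_padicPhase_two_mul_jacobiSym hc hno
  have hn0 : ((c * (∏ p ∈ S, (p : ℕ) : ℕ) : ℤ)) ≠ 0 :=
    mul_ne_zero hc0 (Int.natCast_ne_zero.mpr hno.pos.ne')
  have hred : ∀ p : Nat.Primes,
      padicPhase ((((c * (∏ p ∈ S, (p : ℕ) : ℕ) : ℤ) : ℚ) * b ^ 2 : ℚ) : ℚ_[p]) =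
        padicPhase ((c * (∏ p ∈ S, (p : ℕ) : ℕ) : ℤ) : ℚ_[p]) := by
    intro p
    rw [Rat.cast_mul, Rat.cast_pow, Rat.cast_intCast]
    exact padicPhase_mul_sq (Int.cast_ne_zero.mpr hn0) (Rat.cast_ne_zero.mpr hb)
  have hb2 : (0 : ℝ) < (b : ℝ) ^ 2 := by positivity
  rw [Rat.cast_mul, Rat.cast_pow, Rat.cast_intCast, realPhase_mul_of_pos _ hb2]
  simp only [hred]
  have h2S : twoPrime ∉ S := fun h => hS _ h rfl
  have hprod := hasProd_prod_of_ne_finset_one (L := SummationFilter.unconditional _)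
    (f := fun p : Nat.Primes => padicPhase ((c * (∏ p ∈ S, (p : ℕ) : ℕ) : ℤ) : ℚ_[p]))
    (s := insert twoPrime S) (by
      intro p hp
      rw [Finset.mem_insert, not_or] at hp
      have hp2 : (p : ℕ) ≠ 2 := fun h => hp.1 (Subtype.ext h)
      exact padicPhase_intCast hp2 (hndvd hp2 hp.2))
  -- Here `p` occurs exactly once, so the valuation is `1` and the cofactor is the unit part.
  have hS' : ∀ p ∈ S, padicPhase ((c * (∏ p ∈ S, (p : ℕ) : ℕ) : ℤ) : ℚ_[p]) =
      (if (p : ℕ) % 4 = 1 then 1 else Complex.I) *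
        (legendreSym p (c * (∏ q ∈ S.erase p, (q : ℕ) : ℕ)) : ℂ) := by
    intro p hp
    rw [← padicPhase_prime_mul_intCast (hS p hp) (hndvd (hS p hp) (Finset.notMem_erase p S)),
      ← Finset.mul_prod_erase S _ hp]
    congr 1
    push_cast
    ring
  rw [Finset.prod_insert h2S, Finset.prod_congr rfl hS', prod_legendreSym_erase S hS] at hprod
  rwa [inv_eq_of_mul_eq_one_right key]

theorem realPhase_ne_zero (a : ℝ) : realPhase a ≠ 0 := Complex.exp_ne_zero _

theorem hasProd_one_div_padicPhase {a : ℚ} (ha : a ≠ 0) :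
    HasProd (fun p : Nat.Primes => 1 / padicPhase (a : ℚ_[p])) (realPhase (a : ℝ)) := by
  simpa using (hasProd_padicPhase ha).inv₀ (inv_ne_zero (realPhase_ne_zero _))

end Phase

/-! ### Product formula for the additive characters -/

section Character

theorem not_dvd_den_of_norm_le_one {p : ℕ} [Fact p.Prime] {r : ℚ} (h : ‖(r : ℚ_[p])‖ ≤ 1) :
    ¬ p ∣ r.den := by
  have h1 := PadicInt.isUnit_iff.mp (PadicInt.isUnit_den r h)
  rw [PadicInt.norm_natCast_eq_one_iff] at h1
  exact (Nat.Prime.coprime_iff_not_dvd Fact.out).mp h1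

theorem norm_sub_le_one {p : ℕ} [Fact p.Prime] {x y : ℚ_[p]} (hx : ‖x‖ ≤ 1) (hy : ‖y‖ ≤ 1) :
    ‖x - y‖ ≤ 1 := by
  rw [sub_eq_add_neg]
  exact (Padic.nonarchimedean x (-y)).trans (max_le hx ((norm_neg y).trans_le hy))

/-- A rational number that is integral at every prime is an integer. -/
theorem exists_int_eq_of_forall_norm_le_one {r : ℚ}
    (h : ∀ p : Nat.Primes, ‖(r : ℚ_[p])‖ ≤ 1) : ∃ z : ℤ, r = z := by
  have hd : r.den = 1 := by
    by_contra hd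
    obtain ⟨p, hp, hpd⟩ := Nat.exists_prime_and_dvd hd
    have : Fact p.Prime := ⟨hp⟩
    exact not_dvd_den_of_norm_le_one (h ⟨p, hp⟩) hpd
  exact ⟨r.num, (Rat.den_eq_one_iff r).mp hd |>.symm⟩

theorem norm_sum_fractPart_le_one {p : Nat.Primes} {T : Finset Nat.Primes} (hp : p ∉ T) (α : ℚ) :
    ‖((∑ q ∈ T, fractPart (α : ℚ_[q]) : ℚ) : ℚ_[p])‖ ≤ 1 := by
  push_cast
  refine IsUltrametricDist.norm_sum_le_of_forall_le_of_nonneg zero_le_one fun q hq => ?_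
  exact norm_fractPart_le_one_of_ne (fun h => hp ((Subtype.ext h : p = q) ▸ hq)) _

theorem hasProd_one_div_padicChar (α : ℚ) :
    HasProd (fun p : Nat.Primes => 1 / padicChar (α : ℚ_[p])) (realChar (α : ℝ)) := by
  obtain ⟨T, hT⟩ : ∃ T : Finset Nat.Primes, ∀ p ∉ T, ‖(α : ℚ_[p])‖ ≤ 1 := by
    refine ⟨primesDividing α.den, fun p hp => Padic.norm_rat_le_one fun h => hp ?_⟩
    exact mem_primesDividing.mpr (Nat.mem_primeFactors.mpr ⟨p.2, h, α.den_ne_zero⟩)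
  obtain ⟨z, hz⟩ : ∃ z : ℤ, α - ∑ q ∈ T, fractPart (α : ℚ_[q]) = z := by
    refine exists_int_eq_of_forall_norm_le_one fun p => ?_
    -- At `p ∈ T` the term `{α}_p` removes the polar part of `α`, and the other terms are integral
    -- at `p`.
    by_cases hp : p ∈ T
    · rw [← Finset.add_sum_erase T _ hp, ← sub_sub, Rat.cast_sub, Rat.cast_sub]
      exact norm_sub_le_one (norm_sub_fractPart_le_one _) (norm_sum_fractPart_le_one (Finset.notMem_erase p T) α)
    · rw [Rat.cast_sub]
      exact norm_sub_le_one (hT p hp) (norm_sum_fractPart_le_one hp α)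
  have hprod := hasProd_prod_of_ne_finset_one (L := SummationFilter.unconditional _)
    (f := fun p : Nat.Primes => padicChar (α : ℚ_[p])) (s := T) (by
      intro p hp
      simp [padicChar, fractPart_eq_zero (hT p hp)])
  have hval : ∏ p ∈ T, padicChar (α : ℚ_[p]) = (realChar (α : ℝ))⁻¹ := by
    simp only [padicChar]
    rw [← Complex.exp_sum, ← Finset.mul_sum, realChar, ← Complex.exp_neg, neg_neg,
      Complex.exp_eq_exp_iff_exists_int]
    refine ⟨-z, ?_⟩
    have hz' := congrArg (fun r : ℚ => (r : ℂ)) hz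
    push_cast at hz' ⊢
    linear_combination -(2 * Real.pi * Complex.I) * hz'
  rw [hval] at hprod
  simpa using hprod.inv₀ (inv_ne_zero (Complex.exp_ne_zero _))

end Character

/-! ### Product formula for the norms and their square roots -/

section Norm

theorem hasProd_one_div_norm_natCast {n : ℕ} (hn : n ≠ 0) :
    HasProd (fun p : Nat.Primes => 1 / ‖(n : ℚ_[p])‖) (n : ℝ) := by
  have hf : ∀ p : Nat.Primes, 1 / ‖(n : ℚ_[p])‖ = (((p : ℕ) ^ n.factorization p : ℕ) : ℝ) := by
    intro p
    rw [Padic.norm_eq_zpow_neg_valuation (Nat.cast_ne_zero.mpr hn), Padic.valuation_natCast,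
      zpow_neg, zpow_natCast, one_div, inv_inv, Nat.factorization_def n p.2, Nat.cast_pow]
  simp only [hf]
  have hprod := hasProd_prod_of_ne_finset_one (L := SummationFilter.unconditional _)
    (f := fun p : Nat.Primes => (((p : ℕ) ^ n.factorization p : ℕ) : ℝ))
    (s := primesDividing n) (by
      intro p hp
      rw [mem_primesDividing, ← Nat.support_factorization, Finsupp.notMem_support_iff] at hp
      simp [hp])
  rw [← Nat.cast_prod] at hprod
  have h := (prod_primesDividing n fun p => p ^ n.factorization p).trans
    (Nat.prod_factorization_pow_eq_self hn)
  rwa [h] at hprod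

theorem norm_natAbs_cast {p : ℕ} [Fact p.Prime] (z : ℤ) : ‖(z.natAbs : ℚ_[p])‖ = ‖(z : ℚ_[p])‖ := by
  rcases Int.natAbs_eq z with h | h
  · conv_rhs => rw [h, Int.cast_natCast]
  · conv_rhs => rw [h, Int.cast_neg, Int.cast_natCast, norm_neg]

theorem hasProd_one_div_norm {α : ℚ} (hα : α ≠ 0) :
    HasProd (fun p : Nat.Primes => 1 / ‖(α : ℚ_[p])‖) |(α : ℝ)| := by
  have hnum := hasProd_one_div_norm_natCast (Int.natAbs_ne_zero.mpr (Rat.num_ne_zero.mpr hα))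
  have hden := hasProd_one_div_norm_natCast α.den_ne_zero
  have h := hnum.div₀ hden (Nat.cast_ne_zero.mpr α.den_ne_zero)
  have hr : (α.num.natAbs : ℝ) / α.den = |(α : ℝ)| := by
    rw [Rat.cast_def, abs_div, Nat.abs_cast, Nat.cast_natAbs, Int.cast_abs]
  rw [hr] at h
  refine (funext fun p : Nat.Primes => ?_ : _ = fun p : Nat.Primes => 1 / ‖(α : ℚ_[p])‖) ▸ h
  conv_rhs => rw [Rat.cast_def, norm_div]
  rw [norm_natAbs_cast, div_div_div_eq, one_mul, mul_one, one_div_div]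

/-- The square root of the absolute value, as a monoid homomorphism from `ℝ` to `ℂ`. -/
def sqrtAbsHom : ℝ →* ℂ where
  -- The absolute value makes the map multiplicative on all of `ℝ`, not only on nonnegative numbers.
  toFun x := ((|x| ^ (1 / 2 : ℝ) : ℝ) : ℂ)
  map_one' := by simp
  map_mul' x y := by
    rw [abs_mul, Real.mul_rpow (abs_nonneg x) (abs_nonneg y), Complex.ofReal_mul]

theorem continuous_sqrtAbsHom : Continuous sqrtAbsHom :=
  Complex.continuous_ofReal.comp
    (continuous_abs.rpow_const fun _ => Or.inr (by norm_num))

/-- Unconditional products pass through continuous monoid homomorphisms, here `sqrtAbsHom`. -/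
theorem hasProd_one_div_sqrt_norm {α : ℚ} (hα : α ≠ 0) :
    HasProd (fun p : Nat.Primes => 1 / ((‖(α : ℚ_[p])‖ ^ (1 / 2 : ℝ) : ℝ) : ℂ))
      ((|(α : ℝ)| ^ (1 / 2 : ℝ) : ℝ) : ℂ) := by
  have h := (hasProd_one_div_norm hα).map sqrtAbsHom continuous_sqrtAbsHom
  have h1 : sqrtAbsHom |(α : ℝ)| = ((|(α : ℝ)| ^ (1 / 2 : ℝ) : ℝ) : ℂ) := by
    simp [sqrtAbsHom]
  rw [h1] at h
  convert h using 2 with p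
  simp only [Function.comp_apply, sqrtAbsHom, MonoidHom.coe_mk, OneHom.coe_mk]
  rw [abs_of_nonneg (by positivity), Real.div_rpow zero_le_one (norm_nonneg _), Real.one_rpow,
    Complex.ofReal_div, Complex.ofReal_one]

end Norm

/-- Keeping `b` independent of `a` and `c` covers both normalizations, `b = m / (2 * t)` and `b = m
/ t`. -/
theorem hasProd_one_div_kernel {a b c : ℚ} (ha : a ≠ 0) (hb : b ≠ 0) :
    HasProd (fun p : Nat.Primes => 1 / (padicPhase (a : ℚ_[p]) *
        ((‖(b : ℚ_[p])‖ ^ (1 / 2 : ℝ) : ℝ) : ℂ) * padicChar (c : ℚ_[p])))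
      (realPhase (a : ℝ) * ((|(b : ℝ)| ^ (1 / 2 : ℝ) : ℝ) : ℂ) * realChar (c : ℝ)) := by
  have h := ((hasProd_one_div_padicPhase ha).mul (hasProd_one_div_sqrt_norm hb)).mul
    (hasProd_one_div_padicChar c)
  simpa only [one_div_mul_one_div] using h

end FreeParticle
end

/-- `HasProd f c` says that the infinite product of `f` converges unconditionally to `c`. -/
theorem mainTheorem1 :
    -- the product formula for the additive characters
    (∀ α : ℚ, HasProd (fun p : Nat.Primes => 1 / FreeParticle.padicChar (α : ℚ_[p]))
      (FreeParticle.realChar (α : ℝ))) ∧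
    -- the product formula for the norms
    (∀ α : ℚ, α ≠ 0 → HasProd (fun p : Nat.Primes => 1 / ‖(α : ℚ_[p])‖) |(α : ℝ)|) ∧
    -- the product formula for the phase factors
    (∀ a : ℚ, a ≠ 0 →
      Multipliable (fun p : Nat.Primes => FreeParticle.padicPhase (a : ℚ_[p])) ∧
      FreeParticle.realPhase (a : ℝ) *
        ∏' p : Nat.Primes, FreeParticle.padicPhase (a : ℚ_[p]) = 1) ∧
    -- the product formula for the momentum space propagators
    (∀ m k t : ℚ, m ≠ 0 →
      HasProd (fun p : Nat.Primes =>
          1 / FreeParticle.padicMomentumPropagator (m : ℚ_[p]) (k : ℚ_[p]) (t : ℚ_[p]))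
        (FreeParticle.realMomentumPropagator (m : ℝ) (k : ℝ) (t : ℝ))) ∧
    -- the product formula for the position space propagators
    (∀ m x x' t : ℚ, m ≠ 0 → t ≠ 0 →
      HasProd (fun p : Nat.Primes =>
          1 / FreeParticle.padicPositionPropagator
            (m : ℚ_[p]) (x : ℚ_[p]) (x' : ℚ_[p]) (t : ℚ_[p]))
        (FreeParticle.realPositionPropagator (m : ℝ) (x : ℝ) (x' : ℝ) (t : ℝ))) ∧
    -- the same for the position space propagators in the Fourier normalization
    (∀ m x x' t : ℚ, m ≠ 0 → t ≠ 0 →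
      HasProd (fun p : Nat.Primes =>
          1 / FreeParticle.padicFourierPropagator
            (m : ℚ_[p]) (x : ℚ_[p]) (x' : ℚ_[p]) (t : ℚ_[p]))
        (FreeParticle.realFourierPropagator (m : ℝ) (x : ℝ) (x' : ℝ) (t : ℝ))) := by
  refine ⟨FreeParticle.hasProd_one_div_padicChar, fun _ => FreeParticle.hasProd_one_div_norm,
    fun a ha => ⟨(FreeParticle.hasProd_padicPhase ha).multipliable, ?_⟩, fun m k t _ => ?_,
    fun m x x' t hm ht => ?_, fun m x x' t hm ht => ?_⟩
  · rw [(FreeParticle.hasProd_padicPhase ha).tprod_eq]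
    exact mul_inv_cancel₀ (FreeParticle.realPhase_ne_zero _)
  · have h := FreeParticle.hasProd_one_div_padicChar (k ^ 2 * t / (2 * m))
    push_cast at h
    exact h
  · have h := FreeParticle.hasProd_one_div_kernel (a := t / (2 * m)) (b := m / (2 * t))
      (c := -(m * (x' - x) ^ 2 / (2 * t))) (by positivity) (by positivity)
    push_cast at h
    exact h
  · have h := FreeParticle.hasProd_one_div_kernel (a := t / (2 * m)) (b := m / t)
      (c := -(m * (x' - x) ^ 2 / (2 * t))) (by positivity) (by positivity)
    push_cast at h
    exact h
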